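/- For $\epsilon\in(0,1)$ let $h(\epsilon)=\epsilon\log_2\frac1\epsilon+(1-\epsilon)\log_2\frac1{1-\epsilon}$ be the binary entropy function, and let $P_\epsilon$ be the $\epsilon$-noisy distribution on $\mathbb{F}_2^N$, $P_\epsilon(z)=\epsilon^{|z|}(1-\epsilon)^{N-|z|}$, where $|z|$ is the number of coordinates of $z$ equal to $1$. A set $C\subseteq\mathbb{F}_2^N$ is called transitive if for all $i,j\in\{1,\dots,N\}$ there is a permutation $\pi$ of $\{1,\dots,N\}$ with $\pi(i)=j$ such that $(v_{\pi(1)},\dots,v_{\pi(N)})\in C$ for every $v=(v_1,\dots,v_N)\in C$. Let $\epsilon\in(0,\frac12)$, let $N>\left(\frac5\epsilon\right)^{20}$ be an integer, and let $C\subseteq\mathbb{F}_2^N$ be a transitive linear code (that is, a transitive $\mathbb{F}_2$-linear subspace) of dimension $\dim C<(1-\epsilon^{0.99})N$. Then there exists a function $T$ mapping every $x\in\mathbb{F}_2^N$ to a subset $T(x)\subseteq C$ of size $$|T(x)|\le 2^{(0.99\,h(\epsilon)+5\epsilon)N},$$ such that for every codeword $c\in C$ $$\Pr_{\rho\sim P_\epsilon}\big[c\notin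 T(c+\rho)\big]\le e^{-\frac{\sqrt N}{3\epsilon}}+\frac1{\sqrt N}.$$ -/

import Mathlib

namespace TransitiveCodes

/-- Words of length `N` over the field with two elements. -/
abbrev Word (N : ℕ) : Type := Fin N → ZMod 2

/-- A set `C` of words is transitive if any coordinate `i` can be moved to any coordinate `j` by a
permutation `π` of the coordinates such that `(v_{π(1)}, …, v_{π(N)}) ∈ C` for every `v ∈ C`. -/
def IsTransitive {N : ℕ} (C : Set (Word N)) : Prop :=
  ∀ i j : Fin N, ∃ π : Equiv.Perm (Fin N), π i = j ∧ ∀ v ∈ C, (fun l => v (π l)) ∈ C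

/-- The binary entropy function, with logarithms to base `2`. -/
noncomputable def entropy (ε : ℝ) : ℝ :=
  ε * Real.logb 2 (1 / ε) + (1 - ε) * Real.logb 2 (1 / (1 - ε))

/-- The `ε`-noisy distribution `P_ε(z) = ε^{|z|} (1 - ε)^{N - |z|}`, where `|z|` is the number of
nonzero coordinates of `z` (so `|z| ≤ N`). -/
noncomputable def noisyDist {N : ℕ} (ε : ℝ) (z : Word N) : ℝ :=
  ε ^ hammingNorm z * (1 - ε) ^ (N - hammingNorm z)

/-- The probability that `E ρ` holds, for `ρ` drawn from the `ε`-noisy distribution. -/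
noncomputable def noiseProb {N : ℕ} (ε : ℝ) (E : Word N → Prop) [DecidablePred E] : ℝ :=
  ∑ ρ : Word N with E ρ, noisyDist ε ρ

end TransitiveCodes

/-! Decoding fails only if the noise `ρ` is too heavy or if too many codewords lie at the same
distance `k = |ρ|` from the received word. The latter correspond to words of weight `k` congruent to
`ρ` modulo `C`, so it suffices to bound the number of congruent pairs on each sphere and apply
Markov's inequality. By character orthogonality over the annihilator of `C`, whose dimension is `d =
N - dim C`, that number is controlled by the `2k`-th moment of `∑ j, (-1)^φ(e_j)` for a uniform
annihilating form `φ`. Some `d` of the values `φ(e_j)` form coordinates of `φ`, hence are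
independent and uniform. Transitivity writes the full sum as an average of `N/d` times copies of
this `d`-term sum, so convexity reduces to Khinchin's bound (`sum_sum_unitSgn_pow_le`). The average
number of companions is then at most `2 (const · N/d)^k`, where `N/d < ε^(-0.99)`; with `k` close to
`εN` this gives the term `0.99 h(ε)`. `exists_list_decoder` turns such counts into a decoder. -/

namespace TransitiveCodes

/-! ### Signs, and moments of sums of independent signs -/

/-- The sign `(-1)^a` of an element of the field with two elements. -/
def sgn (a : ZMod 2) : ℝ := if a = 0 then 1 else -1

@[simp] lemma sgn_zero : sgn 0 = 1 := by simp [sgn]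

lemma sgn_add (a b : ZMod 2) : sgn (a + b) = sgn a * sgn b := by
  have h : ∀ a : ZMod 2, a = 0 ∨ a = 1 := by decide
  have h2 : (1 : ZMod 2) + 1 = 0 := by decide
  rcases h a with rfl | rfl <;> rcases h b with rfl | rfl <;> simp [sgn, h2]

lemma sgn_sum {ι : Type*} (s : Finset ι) (f : ι → ZMod 2) :
    sgn (∑ i ∈ s, f i) = ∏ i ∈ s, sgn (f i) := by
  classical
  induction s using Finset.induction_on with
  | empty => simp
  | insert a s ha ih => rw [Finset.sum_insert ha, Finset.prod_insert ha, sgn_add, ih]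

/-- Orthogonality: if some `ψ` in `D` does not vanish at `v`, translation by `ψ` flips every sign
and the sum is zero. -/
lemma sum_sgn_apply_nonneg {V : Type*} [AddCommGroup V] [Module (ZMod 2) V]
    (D : Submodule (ZMod 2) (Module.Dual (ZMod 2) V)) [Fintype D] (v : V) :
    0 ≤ ∑ φ : D, sgn (φ.1 v) := by
  by_cases h : ∀ φ : D, φ.1 v = 0
  · exact Finset.sum_nonneg fun φ _ => by rw [h φ]; simp
  · push Not at h
    obtain ⟨ψ, hψ⟩ := h
    have h1 : ∑ φ : D, sgn (φ.1 v) = ∑ φ : D, sgn ((φ + ψ).1 v) :=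
      (Equiv.sum_comp (Equiv.addRight ψ) fun φ : D => sgn (φ.1 v)).symm
    have h2 : ∀ φ : D, sgn ((φ + ψ).1 v) = - sgn (φ.1 v) := fun φ => by
      simp only [Submodule.coe_add, LinearMap.add_apply, sgn_add]
      simp [sgn, hψ]
    simp only [h2, Finset.sum_neg_distrib] at h1
    linarith

lemma sum_exp_sum_sgn (d : ℕ) (l : ℝ) :
    ∑ s : Fin d → ZMod 2, Real.exp (l * ∑ a, sgn (s a)) = 2 ^ d * Real.cosh l ^ d := by
  have h : ∀ s : Fin d → ZMod 2,
      Real.exp (l * ∑ a, sgn (s a)) = ∏ a, Real.exp (l * sgn (s a)) := fun s => by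
    rw [Finset.mul_sum, Real.exp_sum]
  simp only [h]
  rw [← Fintype.sum_pow (fun b : ZMod 2 => Real.exp (l * sgn b)) d, ← mul_pow]
  congr 1
  have : (Finset.univ : Finset (ZMod 2)) = {0, 1} := by decide
  rw [this, Finset.sum_pair (by decide)]
  simp only [sgn, Real.cosh_eq]
  norm_num
  ring

lemma pow_two_mul_le_factorial_mul_exp (k : ℕ) (x : ℝ) :
    x ^ (2 * k) ≤ (2 * k).factorial * (Real.exp x + Real.exp (-x)) := by
  have h := Real.pow_div_factorial_le_exp |x| (abs_nonneg x) (2 * k)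
  rw [div_le_iff₀ (by positivity), Even.pow_abs ⟨k, two_mul k⟩] at h
  refine h.trans ?_
  rw [mul_comm]
  refine mul_le_mul_of_nonneg_left ?_ (by positivity)
  rcases abs_cases x with ⟨h, _⟩ | ⟨h, _⟩ <;> rw [h]
  · linarith [Real.exp_pos (-x)]
  · linarith [Real.exp_pos x]

/-- Khinchin type bound for the even moments of a sum of `d` independent signs. -/
lemma sum_sum_sgn_pow_le (d k : ℕ) (hd : 0 < d) :
    ∑ s : Fin d → ZMod 2, (∑ a, sgn (s a)) ^ (2 * k) ≤
      2 ^ d * (2 * (2 * Real.exp 1 * k * d) ^ k) := by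
  rcases Nat.eq_zero_or_pos k with rfl | hk
  · simp [ZMod.card]
  have hd' : (0 : ℝ) < d := by exact_mod_cast hd
  have hk' : (0 : ℝ) < k := by exact_mod_cast hk
  -- This `l` minimises `exp (l² d / 2) / l ^ (2k)`, the bound given by `cosh l ≤ exp (l² / 2)`.
  set l : ℝ := √(2 * k / d) with hl
  have hl2 : l ^ 2 = 2 * k / d := Real.sq_sqrt (by positivity)
  have h1 : ∀ s : Fin d → ZMod 2, l ^ (2 * k) * (∑ a, sgn (s a)) ^ (2 * k) ≤
      (2 * k).factorial *
        (Real.exp (l * ∑ a, sgn (s a)) + Real.exp (-l * ∑ a, sgn (s a))) := fun s => by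
    have := pow_two_mul_le_factorial_mul_exp k (l * ∑ a, sgn (s a))
    rwa [mul_pow, ← neg_mul] at this
  have h2 := Finset.sum_le_sum fun s (_ : s ∈ Finset.univ) => h1 s
  rw [← Finset.mul_sum, ← Finset.mul_sum, Finset.sum_add_distrib, sum_exp_sum_sgn,
    sum_exp_sum_sgn, Real.cosh_neg] at h2
  have h3 : Real.cosh l ^ d ≤ Real.exp 1 ^ k := by
    calc Real.cosh l ^ d ≤ Real.exp (l ^ 2 / 2) ^ d :=
          pow_le_pow_left₀ (Real.cosh_pos l).le (Real.cosh_le_exp_half_sq l) d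
      _ = Real.exp 1 ^ k := by
          rw [← Real.exp_nat_mul, ← Real.exp_nat_mul, hl2]
          congr 1
          field_simp
  have h4 : ((2 * k).factorial : ℝ) ≤ (2 * k) ^ (2 * k) := by
    exact_mod_cast Nat.factorial_le_pow (2 * k)
  have h5 : l ^ (2 * k) = (2 * k / d) ^ k := by rw [pow_mul, hl2]
  rw [h5] at h2
  have h6 : (0 : ℝ) < (2 * k / d) ^ k := by positivity
  refine le_of_mul_le_mul_left (h2.trans ?_) h6
  calc ((2 * k).factorial : ℝ) * (2 ^ d * Real.cosh l ^ d + 2 ^ d * Real.cosh l ^ d)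
      ≤ (2 * k) ^ (2 * k) * (2 ^ d * Real.exp 1 ^ k + 2 ^ d * Real.exp 1 ^ k) := by
        have := Real.cosh_pos l
        gcongr
    _ = (2 * k / d) ^ k * (2 ^ d * (2 * (2 * Real.exp 1 * k * d) ^ k)) := by
        have h7 : 2 * Real.exp 1 * (k : ℝ) * d =
            (2 * (k : ℝ) / d)⁻¹ * (2 * (k : ℝ)) ^ 2 * Real.exp 1 := by
          field_simp
        rw [pow_mul, h7, mul_pow _ (Real.exp 1), mul_pow _ ((2 * (k : ℝ)) ^ 2), inv_pow]
        field_simp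
        ring


/-! ### Transitivity and the moments of a random annihilating form -/

/-- A separating family of linear forms contains a coordinate system. -/
lemma exists_bijective_of_separating {K V ι : Type*} [Field K] [AddCommGroup V] [Module K V]
    [FiniteDimensional K V] (ev : ι → Module.Dual K V)
    (h : ∀ x, (∀ j, ev j x = 0) → x = 0) :
    ∃ i : Fin (Module.finrank K V) → ι, Function.Bijective fun x a => ev (i a) x := by
  have hex := Submodule.exists_fun_fin_finrank_span_eq K (Set.range ev)
  obtain ⟨r, hr⟩ : ∃ r, Module.finrank K (Submodule.span K (Set.range ev)) = r := ⟨_, rfl⟩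
  rw [hr] at hex
  obtain ⟨f, hf, hspan, -⟩ := hex
  have hinj : Function.Injective (LinearMap.pi f : V →ₗ[K] Fin r → K) := by
    rw [injective_iff_map_eq_zero]
    intro x hx
    refine h x fun j => ?_
    -- Vanishing at `x` is a linear condition on forms, so it passes from the basis `f` to the whole
    -- span.
    have hle : Submodule.span K (Set.range ev) ≤ LinearMap.ker (Module.Dual.eval K V x) := by
      rw [← hspan, Submodule.span_le]
      rintro _ ⟨a, rfl⟩
      simpa using congrFun hx a
    simpa using hle (Submodule.subset_span ⟨j, rfl⟩)
  have h1 : Module.finrank K V ≤ r := by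
    simpa using LinearMap.finrank_le_finrank_of_injective hinj
  have h2 : r ≤ Module.finrank K V := by
    rw [← Subspace.dual_finrank_eq (K := K) (V := V), ← hr]
    exact Submodule.finrank_le _
  have h3 : Module.finrank K V = r := le_antisymm h1 h2
  choose g hg using hf
  rw [h3]
  refine ⟨g, ?_⟩
  have : (fun x a => ev (g a) x) = (LinearMap.pi f : V →ₗ[K] Fin r → K) := by
    funext x a
    simp [hg]
  rw [this]
  exact ⟨hinj, (LinearMap.injective_iff_surjective_of_finrank_eq_finrank (by simpa)).1 hinj⟩

/-- The coordinate permutations preserving a set of words. -/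
def preservers {N : ℕ} (C : Set (Word N)) : Set (Equiv.Perm (Fin N)) :=
  {g | ∀ v ∈ C, (fun l => v (g l)) ∈ C}

lemma mul_mem_preservers {N : ℕ} {C : Set (Word N)} {g h : Equiv.Perm (Fin N)}
    (hg : g ∈ preservers C) (hh : h ∈ preservers C) : g * h ∈ preservers C :=
  fun v hv => hh _ (hg v hv)

-- Right multiplication by a preserver taking `j'` to `j` injects one fibre into the other.
open Classical in
lemma card_preservers_filter_le {N : ℕ} {C : Set (Word N)} (hC : IsTransitive C)
    (i j j' : Fin N) :
    ({g | g ∈ preservers C ∧ g⁻¹ i = j} : Finset (Equiv.Perm (Fin N))).card ≤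
      ({g | g ∈ preservers C ∧ g⁻¹ i = j'} : Finset (Equiv.Perm (Fin N))).card := by
  obtain ⟨p, hp, hpC⟩ := hC j' j
  refine Finset.card_le_card_of_injOn (fun g => g * p) (fun g hg => ?_)
    (fun g _ g' _ h => mul_right_cancel h)
  simp only [Finset.coe_filter, Finset.mem_univ, true_and, Set.mem_ofPred_eq] at hg ⊢
  refine ⟨mul_mem_preservers hg.1 hpC, ?_⟩
  rw [mul_inv_rev, Equiv.Perm.mul_apply, hg.2, ← hp]
  exact p.symm_apply_apply j'

-- All fibres of `g ↦ g⁻¹ i` have equal size, so `g⁻¹ i` is equidistributed over the coordinates.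
open Classical in
lemma card_mul_sum_preservers {N : ℕ} {C : Set (Word N)} (hC : IsTransitive C)
    (i : Fin N) (f : Fin N → ℝ) :
    (N : ℝ) * ∑ g : Equiv.Perm (Fin N) with g ∈ preservers C, f (g⁻¹ i) =
      ({g | g ∈ preservers C} : Finset (Equiv.Perm (Fin N))).card * ∑ j, f j := by
  set G : Finset (Equiv.Perm (Fin N)) := {g | g ∈ preservers C}
  set m := ({g ∈ G | g⁻¹ i = i} : Finset (Equiv.Perm (Fin N))).card with hm
  have hj : ∀ j, ({g ∈ G | g⁻¹ i = j} : Finset (Equiv.Perm (Fin N))).card = m := fun j => by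
    simp only [hm, G, Finset.filter_filter]
    exact le_antisymm (card_preservers_filter_le hC i j i) (card_preservers_filter_le hC i i j)
  have h1 : G.card = N * m := by
    rw [Finset.card_eq_sum_card_fiberwise (f := fun g => g⁻¹ i) (t := Finset.univ)
      (by intro; simp)]
    simp only [hj, Finset.sum_const, Finset.card_univ, Fintype.card_fin, smul_eq_mul]
  have h2 : ∑ g ∈ G, f (g⁻¹ i) = m * ∑ j, f j := by
    rw [← Finset.sum_fiberwise_of_maps_to (g := fun g => g⁻¹ i) (t := Finset.univ)
      (by intro; simp), Finset.mul_sum]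
    refine Finset.sum_congr rfl fun j _ => ?_
    rw [Finset.sum_congr rfl (g := fun _ => f j), Finset.sum_const, hj, nsmul_eq_mul]
    intro g hg
    rw [(Finset.mem_filter.1 hg).2]
  rw [h1, h2]
  push_cast
  ring

/-- The sign of a linear form at the `j`-th unit vector. -/
def unitSgn {N : ℕ} (φ : Module.Dual (ZMod 2) (Word N)) (j : Fin N) : ℝ :=
  sgn (φ (Pi.single j 1))

/-- Permuting the coordinates in a linear form annihilating `C`. -/
def permuteForm {N : ℕ} {C : Submodule (ZMod 2) (Word N)} {g : Equiv.Perm (Fin N)}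
    (hg : g ∈ preservers (C : Set (Word N))) (φ : C.dualAnnihilator) : C.dualAnnihilator :=
  ⟨φ.1.comp (LinearMap.funLeft (ZMod 2) (ZMod 2) g), by
    rw [Submodule.mem_dualAnnihilator]
    exact fun w hw => (Submodule.mem_dualAnnihilator _).1 φ.2 _ (hg w hw)⟩

lemma permuteForm_injective {N : ℕ} {C : Submodule (ZMod 2) (Word N)} {g : Equiv.Perm (Fin N)}
    (hg : g ∈ preservers (C : Set (Word N))) :
    Function.Injective (permuteForm hg : C.dualAnnihilator → C.dualAnnihilator) := by
  intro φ ψ h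
  ext1
  have h' := congrArg Subtype.val h
  refine (LinearMap.cancel_right (g := LinearMap.funLeft (ZMod 2) (ZMod 2) g) ?_).1 h'
  exact LinearMap.funLeft_surjective_of_injective _ _ _ g.injective

lemma unitSgn_permuteForm {N : ℕ} {C : Submodule (ZMod 2) (Word N)} {g : Equiv.Perm (Fin N)}
    (hg : g ∈ preservers (C : Set (Word N))) (φ : C.dualAnnihilator) (j : Fin N) :
    unitSgn (permuteForm hg φ).1 j = unitSgn φ.1 (g⁻¹ j) := by
  have : LinearMap.funLeft (ZMod 2) (ZMod 2) g (Pi.single j 1) = Pi.single (g⁻¹ j) 1 := by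
    funext l
    simp only [LinearMap.funLeft_apply, Pi.single_apply, Equiv.Perm.eq_inv_iff_eq]
  simp only [unitSgn, permuteForm, LinearMap.comp_apply, this]

/-- For a transitive code, the average of the coordinate signs of a random form annihilating the
code has even moments at most those of the average of `d` independent signs. -/
lemma sum_sum_unitSgn_pow_le {N : ℕ} {C : Submodule (ZMod 2) (Word N)}
    [Fintype C.dualAnnihilator] (hC : IsTransitive (C : Set (Word N))) (hN : 0 < N)
    (hd : 0 < Module.finrank (ZMod 2) C.dualAnnihilator) (k : ℕ) :
    ∑ φ : C.dualAnnihilator, (∑ j, unitSgn φ.1 j) ^ (2 * k) ≤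
      Fintype.card C.dualAnnihilator * (N : ℝ) ^ (2 * k) *
        (2 * (2 * Real.exp 1 * k / Module.finrank (ZMod 2) C.dualAnnihilator) ^ k) := by
  classical
  -- A form is determined by its values at the unit vectors, so `d` of these values are coordinates
  -- on the annihilator: for uniform `φ` they are independent and uniform.
  have hex := exists_bijective_of_separating (K := ZMod 2) (V := C.dualAnnihilator)
    (fun j : Fin N => (Module.Dual.eval (ZMod 2) (Word N) (Pi.single j 1)).comp
      C.dualAnnihilator.subtype) (by
      intro x hx
      ext1
      refine LinearMap.pi_ext' fun j => LinearMap.ext_ring ?_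
      simpa using hx j)
  obtain ⟨d, hdd⟩ : ∃ d, Module.finrank (ZMod 2) C.dualAnnihilator = d := ⟨_, rfl⟩
  rw [hdd] at hd hex ⊢
  obtain ⟨i, hi⟩ := hex
  let e := Equiv.ofBijective _ hi
  have hcard : (Fintype.card C.dualAnnihilator : ℝ) = 2 ^ d := by
    rw [Fintype.card_congr e]
    simp [ZMod.card]
  have hN' : (0 : ℝ) < N := by exact_mod_cast hN
  have hd' : (0 : ℝ) < d := by exact_mod_cast hd
  set G : Finset (Equiv.Perm (Fin N)) := {g | g ∈ preservers (C : Set (Word N))} with hG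
  have hGne : G.Nonempty := ⟨1, by simp [hG, preservers]⟩
  have hGpos : (0 : ℝ) < G.card := by exact_mod_cast hGne.card_pos
  -- Each `a` averages over `G` to `1/N` of the full sum; the `d` indices and the factor `N/d`
  -- restore it.
  have key : ∀ φ : C.dualAnnihilator, (∑ j, unitSgn φ.1 j) =
      ∑ g ∈ G, (G.card : ℝ)⁻¹ * ((N / d : ℝ) * ∑ a, unitSgn φ.1 (g⁻¹ (i a))) := fun φ => by
    rw [← Finset.mul_sum, ← Finset.mul_sum, Finset.sum_comm]
    have h1 : ∀ a, ∑ g ∈ G, unitSgn φ.1 (g⁻¹ (i a)) =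
        (N : ℝ)⁻¹ * (G.card * ∑ j, unitSgn φ.1 j) := fun a => by
      rw [← card_mul_sum_preservers hC (i a), ← mul_assoc, inv_mul_cancel₀ hN'.ne', one_mul]
    simp only [h1, Finset.sum_const, Finset.card_univ, Fintype.card_fin, nsmul_eq_mul]
    field_simp
  have jensen : ∀ φ : C.dualAnnihilator, (∑ j, unitSgn φ.1 j) ^ (2 * k) ≤
      ∑ g ∈ G, (G.card : ℝ)⁻¹ *
        ((N / d : ℝ) * ∑ a, unitSgn φ.1 (g⁻¹ (i a))) ^ (2 * k) := fun φ => by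
    rw [key φ]
    refine Real.pow_arith_mean_le_arith_mean_pow_of_even _ _ _ (fun _ _ => by positivity) ?_
      ⟨k, two_mul k⟩
    rw [Finset.sum_const, nsmul_eq_mul, mul_inv_cancel₀ hGpos.ne']
  -- Permuting by `g` is a bijection of the annihilator, so the coordinates `g⁻¹ (i a)` have the
  -- same joint distribution as the `i a`.
  have inner : ∀ g ∈ G, ∑ φ : C.dualAnnihilator, (∑ a, unitSgn φ.1 (g⁻¹ (i a))) ^ (2 * k) =
      ∑ s : Fin d → ZMod 2, (∑ a, sgn (s a)) ^ (2 * k) := fun g hg => by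
    have hg' : g ∈ preservers (C : Set (Word N)) := (Finset.mem_filter.1 hg).2
    have hb : Function.Bijective (permuteForm hg' : C.dualAnnihilator → C.dualAnnihilator) :=
      Finite.injective_iff_bijective.1 (permuteForm_injective hg')
    simp only [← unitSgn_permuteForm hg']
    rw [hb.sum_comp (fun φ : C.dualAnnihilator => (∑ a, unitSgn φ.1 (i a)) ^ (2 * k))]
    exact e.sum_comp fun s => (∑ a, sgn (s a)) ^ (2 * k)
  calc ∑ φ : C.dualAnnihilator, (∑ j, unitSgn φ.1 j) ^ (2 * k)
      ≤ ∑ φ : C.dualAnnihilator, ∑ g ∈ G, (G.card : ℝ)⁻¹ *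
        ((N / d : ℝ) * ∑ a, unitSgn φ.1 (g⁻¹ (i a))) ^ (2 * k) :=
        Finset.sum_le_sum fun φ _ => jensen φ
    _ = ∑ g ∈ G, (G.card : ℝ)⁻¹ * ((N / d : ℝ) ^ (2 * k) *
          ∑ s : Fin d → ZMod 2, (∑ a, sgn (s a)) ^ (2 * k)) := by
        rw [Finset.sum_comm]
        refine Finset.sum_congr rfl fun g hg => ?_
        simp only [mul_pow (N / d : ℝ)]
        rw [← Finset.mul_sum, ← Finset.mul_sum, inner g hg]
    _ = (N / d : ℝ) ^ (2 * k) * ∑ s : Fin d → ZMod 2, (∑ a, sgn (s a)) ^ (2 * k) := by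
        rw [Finset.sum_const, nsmul_eq_mul, ← mul_assoc, mul_inv_cancel₀ hGpos.ne', one_mul]
    _ ≤ (N / d : ℝ) ^ (2 * k) * (2 ^ d * (2 * (2 * Real.exp 1 * k * d) ^ k)) := by
        gcongr
        exact sum_sum_sgn_pow_le d k hd
    _ = _ := by
        have h7 : 2 * Real.exp 1 * (k : ℝ) * d = (2 * Real.exp 1 * k / d) * (d : ℝ) ^ 2 := by
          field_simp
        rw [hcard, h7, mul_pow _ ((d : ℝ) ^ 2), div_pow, ← pow_mul]
        field_simp


/-! ### Counting congruent pairs of equal weight -/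

/-- The words of Hamming weight `k`. -/
def sphere (N k : ℕ) : Finset (Word N) := {ρ | hammingNorm ρ = k}

lemma mem_sphere {N k : ℕ} {ρ : Word N} : ρ ∈ sphere N k ↔ hammingNorm ρ = k := by
  simp [sphere]

/-- The support of a word. -/
def supp {N : ℕ} (ρ : Word N) : Finset (Fin N) := {l | ρ l ≠ 0}

lemma card_supp {N : ℕ} (ρ : Word N) : (supp ρ).card = hammingNorm ρ := rfl

/-- The sum of the unit vectors listed by `i`. -/
def endpoint {N k : ℕ} (i : Fin k → Fin N) : Word N := ∑ a, Pi.single (i a) 1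

lemma sum_single_supp {N : ℕ} (ρ : Word N) : ∑ l ∈ supp ρ, Pi.single l 1 = ρ := by
  funext m
  have h : ∀ a : ZMod 2, a ≠ 0 → a = 1 := by decide
  simp only [Finset.sum_apply, Pi.single_apply, Finset.sum_ite_eq, supp, Finset.mem_filter,
    Finset.mem_univ, true_and]
  split_ifs with hm
  · exact (h _ hm).symm
  · push Not at hm
    exact hm.symm

/-- The enumeration of the support of `ρ` in the order given by `σ`. -/
noncomputable def enumSupp {N k : ℕ} (ρ : sphere N k) (σ : Equiv.Perm (Fin k)) : Fin k → Fin N :=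
  fun a => (supp ρ.1).orderEmbOfFin ((card_supp ρ.1).trans (mem_sphere.1 ρ.2)) (σ a)

lemma endpoint_enumSupp {N k : ℕ} (ρ : sphere N k) (σ : Equiv.Perm (Fin k)) :
    endpoint (enumSupp ρ σ) = ρ := by
  set h := (card_supp ρ.1).trans (mem_sphere.1 ρ.2)
  rw [endpoint]
  simp only [enumSupp]
  rw [Equiv.sum_comp σ fun a => (Pi.single ((supp ρ.1).orderEmbOfFin h a) 1 : Word N)]
  have himg := Finset.image_orderEmbOfFin_univ (supp ρ.1) h
  conv_rhs => rw [← sum_single_supp ρ.1, ← himg]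
  rw [Finset.sum_image]
  exact fun _ _ _ _ hab => (Finset.orderEmbOfFin _ h).injective hab

lemma enumSupp_injective {N k : ℕ} :
    Function.Injective fun p : sphere N k × Equiv.Perm (Fin k) => enumSupp p.1 p.2 := by
  rintro ⟨ρ, σ⟩ ⟨ρ', σ'⟩ h
  simp only at h
  have hρ : ρ = ρ' := by
    ext1
    rw [← endpoint_enumSupp ρ σ, h, endpoint_enumSupp]
  subst hρ
  have : σ = σ' := by
    ext1 a
    exact (Finset.orderEmbOfFin _ _).injective (congrFun h a)
  rw [this]

/-- Each word of weight `k` is the endpoint of the `k!` orderings of its support; the tuples with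
repeated indices only add nonnegative terms. -/
lemma factorial_mul_sum_sphere_le {N k : ℕ} (F : Word N → ℝ) (hF : ∀ v, 0 ≤ F v) :
    (k.factorial : ℝ) * ∑ ρ ∈ sphere N k, F ρ ≤ ∑ i : Fin k → Fin N, F (endpoint i) := by
  classical
  calc (k.factorial : ℝ) * ∑ ρ ∈ sphere N k, F ρ
      = ∑ p : sphere N k × Equiv.Perm (Fin k), F (endpoint (enumSupp p.1 p.2)) := by
        simp only [endpoint_enumSupp]
        rw [Fintype.sum_prod_type]
        simp only [Finset.sum_const, Finset.card_univ, Fintype.card_perm, Fintype.card_fin,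
          nsmul_eq_mul]
        rw [← Finset.mul_sum, Finset.sum_coe_sort (sphere N k) F]
    _ = ∑ i ∈ Finset.univ.image fun p : sphere N k × Equiv.Perm (Fin k) => enumSupp p.1 p.2,
          F (endpoint i) := by
        rw [Finset.sum_image]
        exact fun _ _ _ _ h => enumSupp_injective h
    _ ≤ _ := Finset.sum_le_sum_of_subset_of_nonneg (Finset.subset_univ _) fun _ _ _ => hF _

/-- The sum over all tuples, unlike the sum over a sphere, factors into a power; this is the gain
from passing to tuples. -/
lemma sum_sgn_endpoint {N k : ℕ} (φ : Module.Dual (ZMod 2) (Word N)) :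
    ∑ i : Fin k → Fin N, sgn (φ (endpoint i)) = (∑ j, unitSgn φ j) ^ k := by
  rw [Fintype.sum_pow]
  refine Finset.sum_congr rfl fun i _ => ?_
  rw [endpoint, map_sum, sgn_sum]
  rfl

/-- The words of weight `k` congruent to `ρ` modulo `C`. -/
noncomputable def companions {N : ℕ} (C : Submodule (ZMod 2) (Word N)) (k : ℕ) (ρ : Word N) :
    Finset (Word N) := by
  classical exact {ρ' ∈ sphere N k | ρ + ρ' ∈ C}

/-- The number of pairs of words of weight `k` that are congruent modulo a transitive code. -/
lemma factorial_sq_mul_sum_card_companions_le {N : ℕ} {C : Submodule (ZMod 2) (Word N)}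
    (hC : IsTransitive (C : Set (Word N))) (hN : 0 < N)
    (hd : 0 < Module.finrank (ZMod 2) C.dualAnnihilator) (k : ℕ) :
    (k.factorial : ℝ) ^ 2 * ∑ ρ ∈ sphere N k, ((companions C k ρ).card : ℝ) ≤
      (N : ℝ) ^ (2 * k) *
        (2 * (2 * Real.exp 1 * k / Module.finrank (ZMod 2) C.dualAnnihilator) ^ k) := by
  classical
  have : Finite (Module.Dual (ZMod 2) (Word N)) := Module.finite_of_finite (ZMod 2)
  have : Fintype C.dualAnnihilator := Fintype.ofFinite _
  have hDpos : (0 : ℝ) < Fintype.card C.dualAnnihilator := by exact_mod_cast Fintype.card_pos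
  -- `F v w` is the size of the annihilator when `v + w ∈ C`; elsewhere only its nonnegativity is
  -- needed.
  set F : Word N → Word N → ℝ := fun v w => ∑ φ : C.dualAnnihilator, sgn (φ.1 (v + w)) with hF
  have hF0 : ∀ v w, 0 ≤ F v w := fun v w => sum_sgn_apply_nonneg _ _
  have h1 : ∀ ρ, Fintype.card C.dualAnnihilator * ((companions C k ρ).card : ℝ) ≤
      ∑ ρ' ∈ sphere N k, F ρ ρ' := fun ρ => by
    calc Fintype.card C.dualAnnihilator * ((companions C k ρ).card : ℝ)
        = ∑ ρ' ∈ companions C k ρ, F ρ ρ' := by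
          rw [mul_comm, ← nsmul_eq_mul, ← Finset.sum_const]
          refine Finset.sum_congr rfl fun ρ' hρ' => ?_
          have hm : ρ + ρ' ∈ C := (Finset.mem_filter.1 hρ').2
          simp only [hF]
          rw [Finset.sum_congr rfl (g := fun _ => (1 : ℝ))]
          · simp
          · intro φ _
            rw [(Submodule.mem_dualAnnihilator _).1 φ.2 _ hm, sgn_zero]
      _ ≤ _ := Finset.sum_le_sum_of_subset_of_nonneg (Finset.filter_subset _ _)
          fun _ _ _ => hF0 _ _
  have h2 : (k.factorial : ℝ) ^ 2 * ∑ ρ ∈ sphere N k, ∑ ρ' ∈ sphere N k, F ρ ρ' ≤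
      ∑ φ : C.dualAnnihilator, (∑ j, unitSgn φ.1 j) ^ (2 * k) := by
    calc (k.factorial : ℝ) ^ 2 * ∑ ρ ∈ sphere N k, ∑ ρ' ∈ sphere N k, F ρ ρ'
        = k.factorial * ∑ ρ ∈ sphere N k, k.factorial * ∑ ρ' ∈ sphere N k, F ρ ρ' := by
          rw [← Finset.mul_sum]; ring
      _ ≤ k.factorial * ∑ ρ ∈ sphere N k, ∑ j : Fin k → Fin N, F ρ (endpoint j) := by
          gcongr with ρ _
          exact factorial_mul_sum_sphere_le _ (hF0 ρ)
      _ ≤ ∑ i : Fin k → Fin N, ∑ j : Fin k → Fin N, F (endpoint i) (endpoint j) :=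
          factorial_mul_sum_sphere_le (fun ρ => ∑ j : Fin k → Fin N, F ρ (endpoint j))
            fun v => Finset.sum_nonneg fun _ _ => hF0 _ _
      _ = ∑ φ : C.dualAnnihilator, (∑ j, unitSgn φ.1 j) ^ (2 * k) := by
          simp only [hF, map_add, sgn_add]
          simp_rw [Finset.sum_comm (s := (Finset.univ : Finset (Fin k → Fin N)))
            (t := (Finset.univ : Finset C.dualAnnihilator))]
          refine Finset.sum_congr rfl fun φ _ => ?_
          simp_rw [← Finset.mul_sum, ← Finset.sum_mul, sum_sgn_endpoint]
          ring
  have h3 := sum_sum_unitSgn_pow_le hC hN hd k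
  refine le_of_mul_le_mul_left ?_ hDpos
  calc Fintype.card C.dualAnnihilator *
        ((k.factorial : ℝ) ^ 2 * ∑ ρ ∈ sphere N k, ((companions C k ρ).card : ℝ))
      = (k.factorial : ℝ) ^ 2 *
          ∑ ρ ∈ sphere N k, Fintype.card C.dualAnnihilator * ((companions C k ρ).card : ℝ) := by
        rw [← Finset.mul_sum]; ring
    _ ≤ (k.factorial : ℝ) ^ 2 * ∑ ρ ∈ sphere N k, ∑ ρ' ∈ sphere N k, F ρ ρ' := by
        gcongr with ρ _
        exact h1 ρ
    _ ≤ _ := h2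
    _ ≤ _ := h3
    _ = _ := by ring

lemma card_sphere (N k : ℕ) : (sphere N k).card = N.choose k := by
  rw [← Finset.card_fin N, ← Finset.card_powersetCard, Finset.card_fin]
  refine Finset.card_bij' (fun ρ _ => supp ρ) (fun s _ => ∑ l ∈ s, Pi.single l 1) ?_ ?_ ?_ ?_
  · intro ρ hρ
    rw [Finset.mem_powersetCard]
    exact ⟨Finset.subset_univ _, (card_supp ρ).trans (mem_sphere.1 hρ)⟩
  · intro s hs
    rw [mem_sphere, ← card_supp, ← (Finset.mem_powersetCard.1 hs).2]
    congr 1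
    ext m
    simp [supp, Finset.sum_apply, Pi.single_apply]
  · exact fun ρ _ => sum_single_supp ρ
  · intro s _
    ext m
    simp [supp, Finset.sum_apply, Pi.single_apply]


/-- Of the two factors `k!`, one is used in `k ^ k ≤ k! e ^ k`, the other in `(N - k) ^ k ≤ k!
(N.choose k)`. The result bounds the average number of companions over a sphere. -/
lemma sum_card_companions_le {N : ℕ} {C : Submodule (ZMod 2) (Word N)}
    (hC : IsTransitive (C : Set (Word N)))
    (hd : 0 < Module.finrank (ZMod 2) C.dualAnnihilator) {k : ℕ} (hk : k < N) :
    ∑ ρ ∈ sphere N k, ((companions C k ρ).card : ℝ) ≤ N.choose k *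
      (2 * ((N / (N - k)) * (2 * Real.exp 1 ^ 2 * N /
        Module.finrank (ZMod 2) C.dualAnnihilator)) ^ k) := by
  have h := factorial_sq_mul_sum_card_companions_le hC (by omega) hd k
  set d := Module.finrank (ZMod 2) C.dualAnnihilator
  have hd' : (0 : ℝ) < d := by exact_mod_cast hd
  have hN : (0 : ℝ) < N := by exact_mod_cast (by omega : 0 < N)
  have hNk : (0 : ℝ) < N - k := by
    have : (k : ℝ) < N := by exact_mod_cast hk
    linarith
  have hf : (0 : ℝ) < k.factorial := by exact_mod_cast k.factorial_pos
  have h1 : ((N : ℝ) - k) ^ k ≤ k.factorial * N.choose k := by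
    have h2 : (N - k) ^ k ≤ N.descFactorial k :=
      (Nat.pow_le_pow_left (by omega) k).trans (Nat.pow_sub_le_descFactorial N k)
    rw [Nat.descFactorial_eq_factorial_mul_choose] at h2
    have h3 : (((N - k) ^ k : ℕ) : ℝ) ≤ ((k.factorial * N.choose k : ℕ) : ℝ) := by
      exact_mod_cast h2
    push_cast [hk.le] at h3
    exact h3
  have h4 : (k : ℝ) ^ k ≤ k.factorial * Real.exp 1 ^ k := by
    have := Real.pow_div_factorial_le_exp (k : ℝ) (by positivity) k
    rw [div_le_iff₀ hf] at this
    rw [← Real.exp_nat_mul, mul_one, mul_comm]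
    exact this
  refine le_of_mul_le_mul_left (h.trans ?_) (pow_pos hf 2)
  have e1 : (N : ℝ) ^ (2 * k) * (2 * (2 * Real.exp 1 * k / d) ^ k) =
      (2 * (N : ℝ) ^ (2 * k) * (2 * Real.exp 1 / d) ^ k) * k ^ k := by
    rw [show 2 * Real.exp 1 * (k : ℝ) / d = (2 * Real.exp 1 / d) * k by ring, mul_pow]
    ring
  have e2 : (k.factorial : ℝ) ^ 2 * (N.choose k *
      (2 * ((N / (N - k)) * (2 * Real.exp 1 ^ 2 * N / d)) ^ k)) =
      (2 * (N : ℝ) ^ (2 * k) * (2 * Real.exp 1 / d) ^ k) *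
        ((k.factorial * Real.exp 1 ^ k) *
          ((k.factorial * N.choose k) * ((N - k : ℝ) ^ k)⁻¹)) := by
    rw [show ((N : ℝ) / (N - k)) * (2 * Real.exp 1 ^ 2 * N / d) =
      (N - k : ℝ)⁻¹ * (N ^ 2 * ((2 * Real.exp 1 / d) * Real.exp 1)) by ring, mul_pow, mul_pow,
      mul_pow, ← pow_mul, inv_pow]
    ring
  rw [e1, e2]
  refine mul_le_mul_of_nonneg_left (h4.trans ?_) (by positivity)
  refine le_mul_of_one_le_right (by positivity) ?_
  rw [← div_eq_mul_inv, one_le_div (pow_pos hNk k)]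
  exact h1

/-! ### Weight of the noise and the list decoder -/

lemma noisyDist_nonneg {N : ℕ} {ε : ℝ} (h0 : 0 ≤ ε) (h1 : ε ≤ 1) (ρ : Word N) :
    0 ≤ noisyDist ε ρ :=
  mul_nonneg (pow_nonneg h0 _) (pow_nonneg (sub_nonneg.2 h1) _)

lemma hammingNorm_le {N : ℕ} (ρ : Word N) : hammingNorm ρ ≤ N := by
  simpa using hammingNorm_le_card_fintype (x := ρ)

/-- Chernoff's bound for the weight of the noise. -/
lemma noiseProb_lt_hammingNorm_le {N : ℕ} {ε l : ℝ} (h0 : 0 ≤ ε) (h1 : ε ≤ 1) (hl : 0 ≤ l)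
    (x : ℝ) [DecidablePred fun ρ : Word N => x < hammingNorm ρ] :
    noiseProb ε (fun ρ : Word N => x < hammingNorm ρ) ≤
      Real.exp (N * (ε * (Real.exp l - 1)) - l * x) := by
  -- Grouping the words by weight turns the generating function into the binomial theorem.
  have hgen : ∑ ρ : Word N, noisyDist ε ρ * Real.exp l ^ hammingNorm ρ =
      (ε * Real.exp l + (1 - ε)) ^ N := by
    rw [add_pow, ← Finset.sum_fiberwise_of_maps_to (g := fun ρ : Word N => hammingNorm ρ)
      (t := Finset.range (N + 1)) (fun ρ _ => Finset.mem_range_succ_iff.2 (hammingNorm_le ρ))]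
    refine Finset.sum_congr rfl fun k _ => ?_
    rw [← card_sphere, mul_comm _ ((sphere N k).card : ℝ), ← nsmul_eq_mul, ← Finset.sum_const]
    refine Finset.sum_congr rfl fun ρ hρ => ?_
    rw [noisyDist, mem_sphere.1 hρ]
    ring
  calc noiseProb ε (fun ρ : Word N => x < hammingNorm ρ)
      ≤ ∑ ρ : Word N with x < hammingNorm ρ,
          Real.exp (-(l * x)) * (noisyDist ε ρ * Real.exp l ^ hammingNorm ρ) := by
        refine Finset.sum_le_sum fun ρ hρ => ?_
        have hx : x < hammingNorm ρ := (Finset.mem_filter.1 hρ).2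
        have : 1 ≤ Real.exp (-(l * x)) * Real.exp l ^ hammingNorm ρ := by
          rw [← Real.exp_nat_mul, ← Real.exp_add, Real.one_le_exp_iff]
          nlinarith
        calc noisyDist ε ρ ≤ noisyDist ε ρ *
              (Real.exp (-(l * x)) * Real.exp l ^ hammingNorm ρ) :=
              le_mul_of_one_le_right (noisyDist_nonneg h0 h1 ρ) this
          _ = _ := by ring
    _ ≤ ∑ ρ : Word N, Real.exp (-(l * x)) * (noisyDist ε ρ * Real.exp l ^ hammingNorm ρ) := by
        refine Finset.sum_le_sum_of_subset_of_nonneg (Finset.filter_subset _ _) fun ρ _ _ => ?_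
        have := noisyDist_nonneg h0 h1 ρ
        positivity
    _ = Real.exp (-(l * x)) * (ε * Real.exp l + (1 - ε)) ^ N := by
        rw [← Finset.mul_sum, hgen]
    _ ≤ Real.exp (-(l * x)) * Real.exp (ε * (Real.exp l - 1)) ^ N := by
        gcongr
        have := Real.add_one_le_exp (ε * (Real.exp l - 1))
        linarith
    _ = _ := by
        rw [← Real.exp_nat_mul, ← Real.exp_add]
        congr 1
        ring

lemma add_self_eq_zero {N : ℕ} (v : Word N) : v + v = 0 := by
  funext l
  exact CharTwo.add_self_eq_zero _

/-- The codewords at distance `k` from `x`. -/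
noncomputable def codewordsAt {N : ℕ} (C : Submodule (ZMod 2) (Word N)) (x : Word N) (k : ℕ) :
    Finset (Word N) := by
  classical exact {c | c ∈ C ∧ hammingNorm (x + c) = k}

/-- A codeword `c'` competing with `c` explains the received word `c + ρ` by the noise `c + ρ + c'`,
which is congruent to `ρ` modulo `C`. -/
lemma card_codewordsAt_le {N : ℕ} {C : Submodule (ZMod 2) (Word N)} {c : Word N} (hc : c ∈ C)
    (ρ : Word N) (k : ℕ) : (codewordsAt C (c + ρ) k).card ≤ (companions C k ρ).card := by
  refine Finset.card_le_card_of_injOn (fun c' => c + ρ + c') (fun c' hc' => ?_)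
    (fun _ _ _ _ h => add_left_cancel h)
  simp only [codewordsAt, companions, Finset.coe_filter, Finset.mem_univ, true_and,
    Set.mem_ofPred_eq, mem_sphere] at hc' ⊢
  refine ⟨hc'.2, ?_⟩
  have : ρ + (c + ρ + c') = c + c' + (ρ + ρ) := by abel
  rw [this, add_self_eq_zero, add_zero]
  exact C.add_mem hc hc'.1

/-- List decoding from a bound on the number of congruent pairs of each weight. -/
lemma exists_list_decoder {N : ℕ} (C : Submodule (ZMod 2) (Word N)) {ε x M B : ℝ}
    (h0 : 0 ≤ ε) (h1 : ε ≤ 1) (hM : 0 ≤ M) (hB : 0 < B)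
    (hcomp : ∀ k : ℕ, k ≤ N → (k : ℝ) ≤ x →
      ∑ ρ ∈ sphere N k, ((companions C k ρ).card : ℝ) ≤ N.choose k * M) :
    ∃ T : Word N → Finset (Word N), (∀ y, (T y : Set (Word N)) ⊆ C) ∧
      (∀ y, ((T y).card : ℝ) ≤ B) ∧
      ∀ c ∈ C, ∀ [DecidablePred fun ρ : Word N => c ∉ T (c + ρ)]
        [DecidablePred fun ρ : Word N => x < hammingNorm ρ],
        noiseProb ε (fun ρ : Word N => c ∉ T (c + ρ)) ≤
          noiseProb ε (fun ρ : Word N => x < hammingNorm ρ) + M * (N + 1) / B := by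
  classical
  set b : ℝ := B / (N + 1) with hb
  have hbpos : 0 < b := by positivity
  -- A distance class is listed only if it has at most `b = B / (N + 1)` codewords; there are `N +
  -- 1` classes.
  refine ⟨fun y => (Finset.range (N + 1)).biUnion fun k =>
    if ((codewordsAt C y k).card : ℝ) ≤ b then codewordsAt C y k else ∅, ?_, ?_, ?_⟩
  · intro y c hc
    obtain ⟨k, -, hk⟩ := Finset.mem_biUnion.1 (Finset.mem_coe.1 hc)
    split_ifs at hk
    · exact (Finset.mem_filter.1 hk).2.1
    · simp at hk
  · intro y
    refine (Nat.cast_le.2 Finset.card_biUnion_le).trans ?_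
    push_cast
    calc ∑ k ∈ Finset.range (N + 1),
          ((if ((codewordsAt C y k).card : ℝ) ≤ b then codewordsAt C y k else ∅).card : ℝ)
        ≤ ∑ k ∈ Finset.range (N + 1), b := by
          refine Finset.sum_le_sum fun k _ => ?_
          split_ifs with h
          · exact h
          · simpa using hbpos.le
      _ = B := by
          rw [Finset.sum_const, Finset.card_range, nsmul_eq_mul, hb]
          push_cast
          field_simp
  · intro c hc _ _
    have hsub : ∀ ρ : Word N, c ∉ (Finset.range (N + 1)).biUnion (fun k =>
        if ((codewordsAt C (c + ρ) k).card : ℝ) ≤ b then codewordsAt C (c + ρ) k else ∅) →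
        x < hammingNorm ρ ∨ ((hammingNorm ρ : ℝ) ≤ x ∧
          b < (companions C (hammingNorm ρ) ρ).card) := by
      intro ρ hρ
      by_contra hcon
      push Not at hcon
      refine hρ (Finset.mem_biUnion.2 ⟨hammingNorm ρ,
        Finset.mem_range_succ_iff.2 (hammingNorm_le ρ), ?_⟩)
      rw [if_pos ((Nat.cast_le.2 (card_codewordsAt_le hc ρ _)).trans (hcon.2 hcon.1))]
      simp only [codewordsAt, Finset.mem_filter, Finset.mem_univ, true_and]
      refine ⟨hc, ?_⟩
      have : c + ρ + c = ρ + (c + c) := by abel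
      rw [this, add_self_eq_zero, add_zero]
    -- Markov's inequality on each sphere, where the noise density is constant; the binomial weights
    -- then sum to `1`.
    have hbad : ∑ ρ : Word N with ((hammingNorm ρ : ℝ) ≤ x ∧
          b < (companions C (hammingNorm ρ) ρ).card), noisyDist ε ρ ≤ M / b := by
      have h1' : 0 ≤ 1 - ε := sub_nonneg.2 h1
      calc ∑ ρ : Word N with ((hammingNorm ρ : ℝ) ≤ x ∧
            b < (companions C (hammingNorm ρ) ρ).card), noisyDist ε ρ
          ≤ ∑ ρ : Word N with (hammingNorm ρ : ℝ) ≤ x,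
              noisyDist ε ρ * ((companions C (hammingNorm ρ) ρ).card / b) := by
            refine (Finset.sum_le_sum (g := fun ρ => noisyDist ε ρ *
              ((companions C (hammingNorm ρ) ρ).card / b)) fun ρ hρ => ?_).trans
              (Finset.sum_le_sum_of_subset_of_nonneg ?_ fun ρ _ _ => ?_)
            · refine le_mul_of_one_le_right (noisyDist_nonneg h0 h1 ρ) ?_
              rw [one_le_div hbpos]
              exact (Finset.mem_filter.1 hρ).2.2.le
            · exact Finset.monotone_filter_right _ fun ρ _ h => h.1
            · have := noisyDist_nonneg h0 h1 ρ
              positivity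
        _ = ∑ k ∈ Finset.range (N + 1), ∑ ρ : Word N with (hammingNorm ρ : ℝ) ≤ x ∧
              hammingNorm ρ = k, noisyDist ε ρ * ((companions C (hammingNorm ρ) ρ).card / b) := by
            rw [← Finset.sum_fiberwise_of_maps_to (g := fun ρ : Word N => hammingNorm ρ)
              (t := Finset.range (N + 1))
              (fun ρ _ => Finset.mem_range_succ_iff.2 (hammingNorm_le ρ))]
            simp only [Finset.filter_filter]
        _ ≤ ∑ k ∈ Finset.range (N + 1), ε ^ k * (1 - ε) ^ (N - k) * N.choose k * (M / b) := by
            refine Finset.sum_le_sum fun k hk => ?_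
            have hkN : k ≤ N := Finset.mem_range_succ_iff.1 hk
            by_cases hkx : (k : ℝ) ≤ x
            · calc ∑ ρ : Word N with (hammingNorm ρ : ℝ) ≤ x ∧ hammingNorm ρ = k,
                    noisyDist ε ρ * ((companions C (hammingNorm ρ) ρ).card / b)
                  = ∑ ρ ∈ sphere N k, ε ^ k * (1 - ε) ^ (N - k) / b *
                      ((companions C k ρ).card : ℝ) := by
                    refine Finset.sum_congr ?_ fun ρ hρ => ?_
                    · ext ρ
                      simp only [Finset.mem_filter, Finset.mem_univ, true_and, mem_sphere]
                      constructor
                      · exact fun h => h.2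
                      · rintro rfl
                        exact ⟨hkx, rfl⟩
                    · rw [noisyDist, mem_sphere.1 hρ]
                      ring
                _ ≤ ε ^ k * (1 - ε) ^ (N - k) / b * (N.choose k * M) := by
                    rw [← Finset.mul_sum]
                    gcongr
                    exact hcomp k hkN hkx
                _ = _ := by ring
            · rw [Finset.filter_false_of_mem, Finset.sum_empty]
              · positivity
              · rintro ρ - ⟨h, rfl⟩
                exact hkx h
        _ = M / b := by
            rw [← Finset.sum_mul, ← add_pow, add_sub_cancel, one_pow, one_mul]
    have hMb : M / b = M * (N + 1) / B := by
      rw [hb]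
      field_simp
    rw [← hMb]
    refine le_trans ?_ (add_le_add le_rfl hbad)
    calc _ ≤ ∑ ρ : Word N with (x < hammingNorm ρ ∨ ((hammingNorm ρ : ℝ) ≤ x ∧
          b < (companions C (hammingNorm ρ) ρ).card)), noisyDist ε ρ := by
          refine Finset.sum_le_sum_of_subset_of_nonneg ?_
            fun ρ _ _ => noisyDist_nonneg h0 h1 ρ
          intro ρ hρ
          exact Finset.mem_filter.2 ⟨Finset.mem_univ _, hsub ρ (Finset.mem_filter.1 hρ).2⟩
      _ ≤ _ := by
          rw [Finset.filter_or]
          rw [noiseProb, ← Finset.sum_union_inter]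
          exact le_add_of_nonneg_right
            (Finset.sum_nonneg fun ρ _ => noisyDist_nonneg h0 h1 ρ)


/-! ### Numerical estimates -/

lemma mul_log_inv_le_log_two_mul_entropy {ε : ℝ} (h0 : 0 < ε) (h1 : ε < 1) :
    ε * Real.log (1 / ε) ≤ Real.log 2 * entropy ε := by
  have h2 : Real.log 2 ≠ 0 := (Real.log_pos one_lt_two).ne'
  have h3 : 0 ≤ (1 - ε) * Real.log (1 / (1 - ε)) := by
    refine mul_nonneg (by linarith) (Real.log_nonneg ?_)
    rw [le_div_iff₀ (by linarith)]
    linarith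
  have h4 : Real.log 2 * entropy ε =
      ε * Real.log (1 / ε) + (1 - ε) * Real.log (1 / (1 - ε)) := by
    rw [entropy, Real.logb, Real.logb]
    field_simp
  linarith

lemma two_le_exp : (2 : ℝ) ≤ Real.exp 0.6932 := by
  rw [← Real.log_le_iff_le_exp two_pos]
  linarith [Real.log_two_lt_d9]

/-- Bounds `N / (N - k)` for `k ≤ 0.503 N`. -/
lemma inv_le_exp : (1 : ℝ) / 0.497 ≤ Real.exp 0.7 := by
  have h : Real.exp 0.7 = Real.exp 0.6932 * Real.exp 0.0068 := by
    rw [← Real.exp_add]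
    norm_num
  have h1 := Real.add_one_le_exp (0.0068 : ℝ)
  have h2 := two_le_exp
  rw [h]
  calc (1 : ℝ) / 0.497 ≤ 2 * (0.0068 + 1) := by norm_num
    _ ≤ _ := by gcongr

/-- The list size bound absorbs all error terms; here `u` is the fourth root of the length. -/
lemma exp_mul_poly_le_rpow {ε u : ℝ} (h0 : 0 < ε) (h1 : ε < 1 / 2) (hu : 3125 / ε ^ 5 < u) :
    2 * Real.exp ((ε * u ^ 4 + 2 * u ^ 3) * (0.99 * Real.log (1 / ε) + 3.4)) *
      (u ^ 4 + 1) * u ^ 2 ≤ (2 : ℝ) ^ ((0.99 * entropy ε + 5 * ε) * u ^ 4) := by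
  have hu' : 3125 < u * ε ^ 5 := by rwa [div_lt_iff₀ (by positivity)] at hu
  have hupos : 0 < u := lt_trans (by positivity) hu
  have hε3 : ε ^ 3 ≤ 1 := pow_le_one₀ h0.le (by linarith)
  have hu2 : 3125 < u * ε ^ 2 := by
    have : u * ε ^ 5 ≤ u * ε ^ 2 := by
      have h := mul_le_mul_of_nonneg_left hε3 (by positivity : 0 ≤ u * ε ^ 2)
      calc u * ε ^ 5 = u * ε ^ 2 * ε ^ 3 := by ring
        _ ≤ u * ε ^ 2 * 1 := h
        _ = _ := mul_one _
    linarith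
  have hu1 : 1 ≤ u := by
    have : ε ^ 2 ≤ 1 := pow_le_one₀ h0.le (by linarith)
    nlinarith
  set t := Real.log (1 / ε) with ht
  have ht1 : t * ε ≤ 1 := by
    have h := Real.log_le_sub_one_of_pos (by positivity : 0 < 1 / ε)
    have h' : t ≤ 1 / ε := by linarith
    rwa [le_div_iff₀ h0] at h'
  have hent := mul_log_inv_le_log_two_mul_entropy h0 (by linarith)
  have hpoly : 2 * (u ^ 4 + 1) * u ^ 2 ≤ Real.exp (8 * u) := by
    have h4 : 2 * (u ^ 4 + 1) * u ^ 2 ≤ 2 ^ 2 * u ^ 6 := by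
      have : 1 ≤ u ^ 4 := one_le_pow₀ hu1
      nlinarith [pow_pos hupos 2]
    have h5 : u ≤ Real.exp u := by linarith [Real.add_one_le_exp u]
    have h6 : 2 ≤ Real.exp u := by linarith [Real.add_one_le_exp u]
    calc _ ≤ 2 ^ 2 * u ^ 6 := h4
      _ ≤ Real.exp u ^ 2 * Real.exp u ^ 6 := by gcongr
      _ = Real.exp (8 * u) := by
        rw [← pow_add, ← Real.exp_nat_mul]
        norm_num
  have hmain : 8 * u + (ε * u ^ 4 + 2 * u ^ 3) * (0.99 * t + 3.4) ≤
      Real.log 2 * ((0.99 * entropy ε + 5 * ε) * u ^ 4) := by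
    -- The excess of `5 log 2` over `3.4` leaves `0.065 ε u ^ 4` to absorb all lower-order terms.
    have hl2 : 3.465 ≤ 5 * Real.log 2 := by linarith [Real.log_two_gt_d9]
    have ha : 0.99 * (ε * t) * u ^ 4 + 3.465 * (ε * u ^ 4) ≤
        Real.log 2 * ((0.99 * entropy ε + 5 * ε) * u ^ 4) := by
      have e1 : Real.log 2 * ((0.99 * entropy ε + 5 * ε) * u ^ 4) =
          0.99 * (Real.log 2 * entropy ε) * u ^ 4 + (5 * Real.log 2) * (ε * u ^ 4) := by ring
      rw [e1]
      gcongr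
    refine le_trans ?_ ha
    have hb : 8 * u + 2 * u ^ 3 * (0.99 * t + 3.4) ≤ 0.065 * (ε * u ^ 4) := by
      refine le_of_mul_le_mul_left ?_ h0
      have hu3 : u ≤ u ^ 3 := le_self_pow₀ hu1 (by norm_num)
      have hc : u ^ 3 * (t * ε) ≤ u ^ 3 * 1 := by gcongr
      have hd : ε * u ≤ 0.5 * u ^ 3 := by nlinarith
      have hee : ε * u ^ 3 ≤ 0.5 * u ^ 3 := by nlinarith [pow_pos hupos 3]
      have hf : 3125 * u ^ 3 ≤ u * ε ^ 2 * u ^ 3 := by gcongr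
      nlinarith
    nlinarith
  have hB : (2 : ℝ) ^ ((0.99 * entropy ε + 5 * ε) * u ^ 4) =
      Real.exp (Real.log 2 * ((0.99 * entropy ε + 5 * ε) * u ^ 4)) :=
    Real.rpow_def_of_pos two_pos _
  rw [hB]
  calc _ = (2 * (u ^ 4 + 1) * u ^ 2) *
        Real.exp ((ε * u ^ 4 + 2 * u ^ 3) * (0.99 * t + 3.4)) := by ring
    _ ≤ Real.exp (8 * u) * Real.exp ((ε * u ^ 4 + 2 * u ^ 3) * (0.99 * t + 3.4)) := by gcongr
    _ ≤ _ := by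
      rw [← Real.exp_add]
      exact Real.exp_le_exp.2 hmain

end TransitiveCodes

/-! ### Choice of parameters and conclusion -/

theorem mainTheorem5 (ε : ℝ) (hε0 : 0 < ε) (hε1 : ε < 1 / 2)
    (N : ℕ) (hN : (5 / ε) ^ 20 < (N : ℝ))
    (C : Submodule (ZMod 2) (TransitiveCodes.Word N))
    (hC : TransitiveCodes.IsTransitive (C : Set (TransitiveCodes.Word N)))
    (hdim : (Module.finrank (ZMod 2) C : ℝ) < (1 - ε ^ (0.99 : ℝ)) * (N : ℝ)) :
    ∃ T : TransitiveCodes.Word N → Finset (TransitiveCodes.Word N),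
      (∀ x, (T x : Set (TransitiveCodes.Word N)) ⊆ C) ∧
      (∀ x, ((T x).card : ℝ) ≤
        (2 : ℝ) ^ ((0.99 * TransitiveCodes.entropy ε + 5 * ε) * (N : ℝ))) ∧
      ∀ c ∈ C, TransitiveCodes.noiseProb ε (fun ρ => c ∉ T (c + ρ)) ≤
        Real.exp (-(√(N : ℝ) / (3 * ε))) + 1 / √(N : ℝ) := by
  classical
  obtain ⟨u, hu, hu2⟩ : ∃ u : ℝ, 3125 / ε ^ 5 < u ∧ √(N : ℝ) = u ^ 2 := by
    refine ⟨√√(N : ℝ), ?_, (Real.sq_sqrt (Real.sqrt_nonneg _)).symm⟩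
    have e1 : 3125 / ε ^ 5 = (5 / ε) ^ 5 := by rw [div_pow]; norm_num
    rw [e1]
    refine Real.lt_sqrt_of_sq_lt (Real.lt_sqrt_of_sq_lt ?_)
    rw [← pow_mul, ← pow_mul]
    exact hN
  have hu4 : (N : ℝ) = u ^ 4 := by
    rw [← Real.sq_sqrt (Nat.cast_nonneg N), hu2]
    ring
  have hupos : 0 < u := lt_trans (by positivity) hu
  have hu' : 3125 < u * ε ^ 5 := by rwa [div_lt_iff₀ (by positivity)] at hu
  have hNpos : (0 : ℝ) < N := by rw [hu4]; positivity
  have hε5 : ε ^ 5 ≤ (1 / 2) ^ 5 := by gcongr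
  have hubig : 100000 < u := by nlinarith
  have huε : 1 ≤ u * ε := by
    have h4 : ε ^ 4 ≤ 1 := pow_le_one₀ hε0.le (by linarith)
    have h5 : u * ε ^ 5 ≤ u * ε := by
      calc u * ε ^ 5 = u * ε * ε ^ 4 := by ring
        _ ≤ u * ε * 1 := by gcongr
        _ = _ := mul_one _
    linarith
  have hsum : Module.finrank (ZMod 2) C + Module.finrank (ZMod 2) C.dualAnnihilator = N := by
    rw [Subspace.finrank_add_finrank_dualAnnihilator_eq]
    simp
  have hd : ε ^ (0.99 : ℝ) * N < Module.finrank (ZMod 2) C.dualAnnihilator := by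
    have : (Module.finrank (ZMod 2) C : ℝ) + Module.finrank (ZMod 2) C.dualAnnihilator = N := by
      exact_mod_cast hsum
    linarith
  have hdpos : (0 : ℝ) < Module.finrank (ZMod 2) C.dualAnnihilator :=
    lt_trans (by positivity) hd
  set d := Module.finrank (ZMod 2) C.dualAnnihilator with hdd
  set t := Real.log (1 / ε) with ht
  have htpos : 0 ≤ t := Real.log_nonneg (by rw [le_div_iff₀ hε0]; linarith)
  have hNd : (N : ℝ) / d ≤ Real.exp (0.99 * t) := by
    have e1 : Real.exp (0.99 * t) = (ε ^ (0.99 : ℝ))⁻¹ := by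
      rw [Real.rpow_def_of_pos hε0, ← Real.exp_neg, ht, one_div, Real.log_inv]
      congr 1
      ring
    have hpos : 0 < ε ^ (0.99 : ℝ) := by positivity
    rw [e1, div_le_iff₀ hdpos, ← div_eq_inv_mul, le_div_iff₀ hpos]
    linarith
  -- With `u = N ^ (1/4)`, the weight threshold is the mean `εN` plus the deviation `2 N ^ (3/4)`.
  set x : ℝ := ε * u ^ 4 + 2 * u ^ 3 with hx
  have hxN : x ≤ 0.503 * N := by
    rw [hu4, hx]
    nlinarith [pow_pos hupos 3, pow_pos hupos 4]
  obtain ⟨T, hT1, hT2, hT3⟩ := TransitiveCodes.exists_list_decoder C (ε := ε) (x := x)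
    (M := 2 * Real.exp (x * (0.99 * t + 3.4)))
    (B := (2 : ℝ) ^ ((0.99 * TransitiveCodes.entropy ε + 5 * ε) * (N : ℝ)))
    hε0.le (by linarith) (by positivity) (by positivity) (by
      intro k _ hkx
      have hkN : (k : ℝ) ≤ 0.503 * N := hkx.trans hxN
      have hlt : (k : ℝ) < N := by linarith
      refine (TransitiveCodes.sum_card_companions_le hC (by exact_mod_cast hdpos)
        (by exact_mod_cast hlt)).trans ?_
      rw [← hdd]
      have hNk : (0 : ℝ) < N - k := by linarith
      have hb1 : (N : ℝ) / (N - k) ≤ Real.exp 0.7 := by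
        refine le_trans ?_ TransitiveCodes.inv_le_exp
        rw [div_le_div_iff₀ hNk (by norm_num)]
        linarith
      -- The exponents `0.7`, `0.6932` (from the factor `2`) and `2` (from `e²`) add up to `3.3932`,
      -- rounded up to `3.4`.
      have hbase : (N : ℝ) / (N - k) * (2 * Real.exp 1 ^ 2 * N / d) ≤
          Real.exp (0.99 * t + 3.4) := by
        calc (N : ℝ) / (N - k) * (2 * Real.exp 1 ^ 2 * N / d)
            = (N : ℝ) / (N - k) * (2 * Real.exp 1 ^ 2 * (N / d)) := by ring
          _ ≤ Real.exp 0.7 * (Real.exp 0.6932 * Real.exp 1 ^ 2 * Real.exp (0.99 * t)) := by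
              gcongr
              exact TransitiveCodes.two_le_exp
          _ = Real.exp (0.99 * t + 3.3932) := by
              rw [← Real.exp_nat_mul, ← Real.exp_add, ← Real.exp_add, ← Real.exp_add]
              congr 1
              push_cast
              ring
          _ ≤ _ := Real.exp_le_exp.2 (by linarith)
      gcongr
      calc _ ≤ Real.exp (0.99 * t + 3.4) ^ k := by gcongr
        _ = Real.exp (k * (0.99 * t + 3.4)) := (Real.exp_nat_mul _ _).symm
        _ ≤ _ := by gcongr)
  refine ⟨T, hT1, hT2, fun c hc => (hT3 c hc).trans (add_le_add ?_ ?_)⟩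
  -- For `l = 1 / (uε) ≤ 1`, the estimate `exp l - 1 ≤ l + l²` leaves the exponent `u²/ε - 2u²/ε =
  -- -u²/ε`, more than required.
  · refine (TransitiveCodes.noiseProb_lt_hammingNorm_le (l := 1 / (u * ε)) hε0.le (by linarith)
      (by positivity) x).trans (Real.exp_le_exp.2 ?_)
    have hl1 : 1 / (u * ε) ≤ 1 := by
      rw [div_le_one (by positivity)]
      exact huε
    have hexp := (abs_le.1 (Real.abs_exp_sub_one_sub_id_le (x := 1 / (u * ε))
      (by rw [abs_of_pos (by positivity)]; exact hl1))).2
    rw [hu2, hu4]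
    calc u ^ 4 * (ε * (Real.exp (1 / (u * ε)) - 1)) - 1 / (u * ε) * x
        ≤ u ^ 4 * (ε * (1 / (u * ε) + (1 / (u * ε)) ^ 2)) - 1 / (u * ε) * x := by
          gcongr
          linarith
      _ = -(u ^ 2 / ε) := by
          rw [hx]
          field_simp
          ring
      _ ≤ -(u ^ 2 / (3 * ε)) := by
          gcongr
          linarith
  · have hfin := TransitiveCodes.exp_mul_poly_le_rpow hε0 hε1 hu
    rw [hu2, hu4, div_le_div_iff₀ (by positivity) (by positivity), one_mul]
    exact hfin
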